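/- For a finite-dimensional real Lie algebra $\mathfrak g$ let $(\Lambda\mathfrak g)^{\mathfrak g}$ and $(\Lambda\mathfrak g^*)^{\mathfrak g}$ denote the invariants in the exterior algebras of $\mathfrak g$ and of its dual, let $\Lambda^+$ denote the part of positive degree, and let $$P_{\mathfrak g^*}=\{\alpha\in(\Lambda^+\mathfrak g^*)^{\mathfrak g} : \alpha(x\wedge y)=0 \text{ for all } x,y\in(\Lambda^+\mathfrak g)^{\mathfrak g}\}$$ be the space of primitive elements. If $\theta$ is an involution of $\mathfrak g$, then $(P_{\mathfrak g^*})^{-\theta}$ denotes the $(-1)$-eigenspace of the map that $\theta$ induces on $P_{\mathfrak g^*}$. A reductive pair $(\mathfrak g,\mathfrak h)$ with Cartan involution $\theta$ consists of a (finite-dimensional, real) reductive Lie algebra $\mathfrak g$ with a Cartan involution $\theta$ and a subalgebra $\mathfrak h\subset\mathfrak g$ with $\theta(\mathfrak h)=\mathfrak h$. Restriction of forms then gives a well-defined linear map $\mathrm{rest}:(P_{\mathfrak g^*})^{-\theta}\to(P_{\mathfrak h^*})^{-\theta}$. Proposition. Let $(\mathfrak g_0,\mathfrak h_0)$ be a reductive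 pair with Cartan involution $\theta_0$. Let $\mathfrak g=\mathbb C\otimes\mathfrak g_0$ and $\mathfrak h=\mathbb C\otimes\mathfrak h_0$ be the complexifications, let $\mathfrak g_{\mathbb R},\mathfrak h_{\mathbb R}$ be $\mathfrak g,\mathfrak h$ regarded as real Lie algebras, and let $\theta$ be the Cartan involution of $\mathfrak g_{\mathbb R}$ that is the complex antilinear extension of $\theta_0$. Then restriction gives well-defined maps $$(P_{\mathfrak g_{\mathbb R}^*})^{-\theta}\to(P_{\mathfrak h_{\mathbb R}^*})^{-\theta}\quad\text{and}\quad (P_{\mathfrak g_0^*})^{-\theta_0}\to(P_{\mathfrak h_0^*})^{-\theta_0},$$ and if the first of these is surjective, then so is the second. -/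

import Mathlib

open scoped TensorProduct

namespace RedPair

/-! ### The derivation of the exterior algebra that extends a linear endomorphism -/

section Exterior

variable {V : Type*} [AddCommGroup V] [Module ℝ V]

/-- The linear map `v ↦ v + ε f(v)` from `V` to the dual numbers over `Λ V`. -/
noncomputable def derLin (f : V →ₗ[ℝ] V) :
    V →ₗ[ℝ] TrivSqZeroExt (ExteriorAlgebra ℝ V) (ExteriorAlgebra ℝ V) where
  toFun v := TrivSqZeroExt.inl (ExteriorAlgebra.ι ℝ v) +
    TrivSqZeroExt.inr (ExteriorAlgebra.ι ℝ (f v))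
  map_add' v w := by ext <;> simp
  map_smul' c v := by ext <;> simp

theorem derLin_sq (f : V →ₗ[ℝ] V) (v : V) : derLin f v * derLin f v = 0 := by
  ext
  · simp [derLin]
  · simp [derLin, ExteriorAlgebra.ι_add_mul_swap v (f v)]

/-- The algebra homomorphism `w ↦ w + ε D_f(w)` from `Λ V` to the dual numbers over `Λ V`. -/
noncomputable def derAlg (f : V →ₗ[ℝ] V) :
    ExteriorAlgebra ℝ V →ₐ[ℝ] TrivSqZeroExt (ExteriorAlgebra ℝ V) (ExteriorAlgebra ℝ V) :=
  ExteriorAlgebra.lift ℝ ⟨derLin f, derLin_sq f⟩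

/-- The derivation `D_f` of `Λ V` that extends `f : V → V`, that is,
`D_f (v₁ ∧ ⋯ ∧ vₖ) = ∑ᵢ v₁ ∧ ⋯ ∧ f(vᵢ) ∧ ⋯ ∧ vₖ`. The three lemmas below characterize it. -/
noncomputable def extDer (f : V →ₗ[ℝ] V) : ExteriorAlgebra ℝ V →ₗ[ℝ] ExteriorAlgebra ℝ V where
  toFun w := (derAlg f w).snd
  map_add' v w := by simp
  map_smul' c v := by simp

theorem extDer_one (f : V →ₗ[ℝ] V) : extDer f 1 = 0 := by
  simp [extDer]

theorem extDer_ι (f : V →ₗ[ℝ] V) (v : V) :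
    extDer f (ExteriorAlgebra.ι ℝ v) = ExteriorAlgebra.ι ℝ (f v) := by
  simp [extDer, derAlg, derLin]

theorem derAlg_fst (f : V →ₗ[ℝ] V) (w : ExteriorAlgebra ℝ V) : (derAlg f w).fst = w := by
  have h : (TrivSqZeroExt.fstHom ℝ (ExteriorAlgebra ℝ V) (ExteriorAlgebra ℝ V)).comp (derAlg f) =
      AlgHom.id ℝ (ExteriorAlgebra ℝ V) := by
    ext v
    simp [derAlg, derLin]
  exact DFunLike.congr_fun h w

theorem extDer_mul (f : V →ₗ[ℝ] V) (u w : ExteriorAlgebra ℝ V) :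
    extDer f (u * w) = extDer f u * w + u * extDer f w := by
  simp [extDer, derAlg_fst, add_comm]

end Exterior

/-! ### Invariants and primitive elements -/

section Primitive

variable (L : Type*) [LieRing L] [LieAlgebra ℝ L]

/-- `(Λ⁺ L)^L`: the elements of positive degree (zero component in `Λ⁰ L = ℝ`) of the exterior
algebra `Λ L` that are annihilated by `L`, which acts by the derivations extending `ad`. -/
noncomputable def posInvariants : Submodule ℝ (ExteriorAlgebra ℝ L) where
  carrier := {w | ExteriorAlgebra.algebraMapInv w = 0 ∧
    ∀ x : L, extDer (LieAlgebra.ad ℝ L x : L →ₗ[ℝ] L) w = 0}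
  add_mem' := by
    rintro a b ⟨ha, ha'⟩ ⟨hb, hb'⟩
    exact ⟨by simp [ha, hb], fun x => by simp [ha' x, hb' x]⟩
  zero_mem' := by simp
  smul_mem' := by
    rintro c a ⟨ha, ha'⟩
    exact ⟨by simp [ha], fun x => by simp [ha' x]⟩

/-- The space `P_{L^*}` of primitive elements in `(Λ L^*)^L`. For finite-dimensional `L`, elements
of `Λ L^*` are the same as linear forms on `Λ L`, and they are represented in this way. The
conditions say in turn: `α` has positive degree, `α` is `L`-invariant, and `α` vanishes on
products of two invariants of positive degree. -/
noncomputable def primitive : Submodule ℝ (Module.Dual ℝ (ExteriorAlgebra ℝ L)) where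
  carrier := {α | α 1 = 0 ∧
    (∀ (x : L) (w : ExteriorAlgebra ℝ L), α (extDer (LieAlgebra.ad ℝ L x : L →ₗ[ℝ] L) w) = 0) ∧
    ∀ u ∈ posInvariants L, ∀ w ∈ posInvariants L, α (u * w) = 0}
  add_mem' := by
    rintro a b ⟨ha, ha', ha''⟩ ⟨hb, hb', hb''⟩
    exact ⟨by simp [ha, hb], fun x w => by simp [ha' x w, hb' x w],
      fun u hu w hw => by simp [ha'' u hu w hw, hb'' u hu w hw]⟩
  zero_mem' := by simp
  smul_mem' := by
    rintro c a ⟨ha, ha', ha''⟩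
    exact ⟨by simp [ha], fun x w => by simp [ha' x w],
      fun u hu w hw => by simp [ha'' u hu w hw]⟩

variable {L}

/-- `(P_{L^*})^{-θ}`: the `(-1)`-eigenspace in `P_{L^*}` of the map induced by `θ : L → L`. -/
noncomputable def primitiveAnti (θ : L →ₗ[ℝ] L) :
    Submodule ℝ (Module.Dual ℝ (ExteriorAlgebra ℝ L)) where
  carrier := {α | α ∈ primitive L ∧
    ∀ w : ExteriorAlgebra ℝ L, α (ExteriorAlgebra.map θ w) = -α w}
  add_mem' := by
    rintro a b ⟨ha, ha'⟩ ⟨hb, hb'⟩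
    exact ⟨add_mem ha hb, fun w => by simp [ha' w, hb' w, add_comm]⟩
  zero_mem' := ⟨zero_mem _, by simp⟩
  smul_mem' := by
    rintro c a ⟨ha, ha'⟩
    exact ⟨Submodule.smul_mem _ _ ha, fun w => by simp [ha' w]⟩

/-- The restriction map `Λ L^* → Λ H^*` for a subalgebra `H` of `L`. -/
noncomputable def rest (H : LieSubalgebra ℝ L) :
    Module.Dual ℝ (ExteriorAlgebra ℝ L) →ₗ[ℝ] Module.Dual ℝ (ExteriorAlgebra ℝ H) :=
  Module.Dual.transpose (R := ℝ)
    (ExteriorAlgebra.map (H.incl : H →ₗ[ℝ] L)).toLinearMap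

end Primitive

/-! ### Reductive pairs -/

/-- `θ` is a Cartan involution of the real reductive Lie algebra `L`: an involutive automorphism
for which there is a `θ`-invariant and `ad`-invariant symmetric bilinear form `B` such that
`(x, y) ↦ -B(x, θ y)` is positive definite. The existence of such a `B` makes `L` reductive
(see `IsCartanInvolution.complementedLattice`); for semisimple `L` the Killing form will do, and for
reductive `L` the condition says that `-κ(x, θ x) > 0` for all `0 ≠ x ∈ [L, L]`, with `κ` the Killing
form, while `θ` may be any involution on the centre. -/
structure IsCartanInvolution {L : Type*} [LieRing L] [LieAlgebra ℝ L] (θ : L →ₗ⁅ℝ⁆ L) : Prop where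
  involutive : ∀ x, θ (θ x) = x
  exists_form : ∃ B : LinearMap.BilinForm ℝ L,
    (∀ x y, B x y = B y x) ∧
    (∀ x y z, B ⁅x, y⁆ z = B x ⁅y, z⁆) ∧
    (∀ x y, B (θ x) (θ y) = B x y) ∧
    ∀ x, x ≠ 0 → B x (θ x) < 0

/-- A Lie algebra with a Cartan involution is reductive: each ideal has a complementary ideal. -/
theorem IsCartanInvolution.complementedLattice {L : Type*} [LieRing L] [LieAlgebra ℝ L]
    [FiniteDimensional ℝ L] {θ : L →ₗ⁅ℝ⁆ L} (hθ : IsCartanInvolution θ) :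
    ComplementedLattice (LieIdeal ℝ L) := by
  obtain ⟨B, hsymm, hinv, hB, hpos⟩ := hθ.exists_form
  refine ⟨fun I => ?_⟩
  let J : LieIdeal ℝ L :=
    { carrier := {y | ∀ x ∈ I, B x (θ y) = 0}
      add_mem' := fun ha hb x hx => by simp [ha x hx, hb x hx]
      zero_mem' := fun x _ => by simp
      smul_mem' := fun c a ha x hx => by simp [ha x hx]
      lie_mem := fun {z a} ha x hx => by
        rw [LieHom.map_lie, ← hinv]
        exact ha _ (lie_mem_left ℝ L I _ _ hx) }
  have hinf : I ⊓ J = ⊥ := by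
    rw [eq_bot_iff]
    rintro x ⟨hxI, hxJ⟩
    by_contra hx
    exact (hpos x (by simpa using hx)).ne (hxJ x hxI)
  refine ⟨J, disjoint_iff.mpr hinf, codisjoint_iff.mpr ?_⟩
  let C : LinearMap.BilinForm ℝ L := B.compl₂ (θ : L →ₗ[ℝ] L)
  have hC : ∀ x y, C x y = B x (θ y) := fun x y => rfl
  have hCrefl : C.IsRefl := by
    intro x y h
    rw [hC] at h ⊢
    rw [← hB, hθ.involutive, hsymm, h]
  have hdisj : Disjoint I.toSubmodule (C.orthogonal I.toSubmodule) := by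
    rw [Submodule.disjoint_def]
    intro x hx hx'
    by_contra h
    exact (hpos x h).ne (hx' x hx)
  have hsup := ((LinearMap.BilinForm.isCompl_orthogonal_iff_disjoint hCrefl).mpr hdisj).sup_eq_top
  rw [← LieSubmodule.toSubmodule_inj, LieSubmodule.sup_toSubmodule]
  exact hsup

/-- A reductive pair `(L, H)`: a real reductive Lie algebra `L` with a Cartan involution `θ` and a
subalgebra `H` of `L` with `θ(H) = H`. -/
structure ReductivePair (L : Type*) [LieRing L] [LieAlgebra ℝ L] where
  θ : L →ₗ⁅ℝ⁆ L
  cartan : IsCartanInvolution θ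
  H : LieSubalgebra ℝ L
  map_H : H.map θ = H

namespace ReductivePair

variable {L : Type*} [LieRing L] [LieAlgebra ℝ L] (P : ReductivePair L)

theorem θ_mem {x : L} (hx : x ∈ P.H) : P.θ x ∈ P.H := by
  rw [← P.map_H]
  exact ⟨x, hx, rfl⟩

/-- The restriction of `θ` to `H`. -/
noncomputable def θH : P.H →ₗ[ℝ] P.H :=
  (P.θ : L →ₗ[ℝ] L).restrict (p := P.H.toSubmodule) (q := P.H.toSubmodule) fun _ hx => P.θ_mem hx

/-- Restriction carries `(P_{L^*})^{-θ}` into `(P_{H^*})^{-θ}`. -/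
def RestWellDefined : Prop :=
  ∀ α ∈ primitiveAnti (P.θ : L →ₗ[ℝ] L), rest P.H α ∈ primitiveAnti P.θH

/-- The restriction map `(P_{L^*})^{-θ} → (P_{H^*})^{-θ}`. -/
noncomputable def restAnti (h : P.RestWellDefined) :
    primitiveAnti (P.θ : L →ₗ[ℝ] L) →ₗ[ℝ] primitiveAnti P.θH :=
  (rest P.H).restrict h

/-- The antilinear extension `z ⊗ x ↦ conj z ⊗ θ x` of `θ` to `ℂ ⊗ L`, seen as a homomorphism of
real Lie algebras. -/
noncomputable def θConj : ℂ ⊗[ℝ] L →ₗ⁅ℝ⁆ ℂ ⊗[ℝ] L :=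
  LieAlgebra.ExtendScalars.map Complex.conjAe.toAlgHom P.θ

theorem θConj_isCartanInvolution : IsCartanInvolution P.θConj := by
  obtain ⟨B, hsymm, hinv, hθ, hpos⟩ := P.cartan.exists_form
  let R : LinearMap.BilinForm ℝ ℂ := (LinearMap.mul ℝ ℂ).compr₂ Complex.reLm
  let T : LinearMap.BilinForm ℝ (ℂ ⊗[ℝ] L) := LinearMap.BilinForm.tmul R B
  have hT : ∀ (a b : ℂ) (x y : L), T (a ⊗ₜ x) (b ⊗ₜ y) = (a * b).re * B x y := fun a b x y => by
    simp [T, R, mul_comm]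
  have hc : ∀ (a : ℂ) (x : L), P.θConj (a ⊗ₜ x) = (starRingEnd ℂ a) ⊗ₜ P.θ x := fun a x => rfl
  refine ⟨fun z => ?_, T, fun z w => ?_, fun z w v => ?_, fun z w => ?_, fun z hz => ?_⟩
  · induction z with
    | zero => simp
    | tmul a x => simp [hc, P.cartan.involutive x]
    | add a b ha hb => simp [ha, hb]
  · induction z with
    | zero => simp
    | add a b ha hb => simp [ha, hb]
    | tmul a x =>
      induction w with
      | zero => simp
      | add a b ha hb => simp [ha, hb]
      | tmul b y => rw [hT, hT, mul_comm a b, hsymm x y]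
  · induction z with
    | zero => simp
    | add a b ha hb => simp [ha, hb]
    | tmul a x =>
      induction w with
      | zero => simp
      | add a b ha hb => simp [ha, hb]
      | tmul b y =>
        induction v with
        | zero => simp
        | add a b ha hb => simp only [map_add, lie_add, ha, hb]
        | tmul c t =>
          simp only [LieAlgebra.ExtendScalars.bracket_tmul, hT, hinv, mul_assoc]
  · induction z with
    | zero => simp
    | add a b ha hb => simp [ha, hb]
    | tmul a x =>
      induction w with
      | zero => simp
      | add a b ha hb => simp [ha, hb]
      | tmul b y => rw [hc, hc, hT, hT, hθ, ← map_mul, Complex.conj_re]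
  · obtain ⟨x, y, rfl⟩ : ∃ x y : L, z = (1 : ℂ) ⊗ₜ[ℝ] x + Complex.I ⊗ₜ[ℝ] y := by
      clear hz
      induction z with
      | zero => exact ⟨0, 0, by simp⟩
      | add a b ha hb =>
        obtain ⟨x, y, rfl⟩ := ha
        obtain ⟨x', y', rfl⟩ := hb
        exact ⟨x + x', y + y', by simp only [TensorProduct.tmul_add]; abel⟩
      | tmul a x =>
        refine ⟨a.re • x, a.im • x, ?_⟩
        rw [← TensorProduct.smul_tmul, ← TensorProduct.smul_tmul, ← TensorProduct.add_tmul]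
        congr 1
        apply Complex.ext <;> simp
    have hle : ∀ x, B x (P.θ x) ≤ 0 := fun x => by
      rcases eq_or_ne x 0 with rfl | h
      · simp
      · exact (hpos x h).le
    have key : T ((1 : ℂ) ⊗ₜ[ℝ] x + Complex.I ⊗ₜ[ℝ] y)
        (P.θConj ((1 : ℂ) ⊗ₜ[ℝ] x + Complex.I ⊗ₜ[ℝ] y)) = B x (P.θ x) + B y (P.θ y) := by
      simp [hc, hT]
    rw [key]
    rcases eq_or_ne x 0 with rfl | hx
    · have hy : y ≠ 0 := by
        rintro rfl
        simp at hz
      simpa using hpos y hy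
    · linarith [hpos x hx, hle y]

/-- The complexification `ℂ ⊗ H`, as a subspace of `ℂ ⊗ L`, seen as a real Lie subalgebra. -/
noncomputable def HC : LieSubalgebra ℝ (ℂ ⊗[ℝ] L) :=
  (LieAlgebra.ExtendScalars.map (AlgHom.id ℝ ℂ) P.H.incl).range

/-- The complexification of a reductive pair, with `ℂ ⊗ L` and `ℂ ⊗ H` regarded as real Lie
algebras and with the Cartan involution that is the antilinear extension of `θ`. -/
noncomputable def complexify : ReductivePair (ℂ ⊗[ℝ] L) where
  θ := P.θConj
  cartan := P.θConj_isCartanInvolution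
  H := P.HC
  map_H := by
    have hsub : ∀ z ∈ P.HC, P.θConj z ∈ P.HC := by
      rintro _ ⟨w, rfl⟩
      refine ⟨TensorProduct.map Complex.conjAe.toAlgHom.toLinearMap P.θH w, ?_⟩
      induction w with
      | zero => simp
      | tmul a x => rfl
      | add a b ha hb => simp only [map_add, ha, hb]
    apply le_antisymm
    · rintro _ ⟨z, hz, rfl⟩
      exact hsub z hz
    · intro z hz
      exact ⟨P.θConj z, hsub z hz, P.θConj_isCartanInvolution.involutive z⟩

end ReductivePair

end RedPair

/-!
The exterior algebra `Λ L` carries the boundary operator `∂` of Lie algebra homology, and an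
invariant form vanishes on the product of a cycle and a boundary. A Cartan involution of `L` yields
an inner product on `Λ L` for which the adjoint of the action of `x` is the action of `-θ x`. Hence
`Λ L` is completely reducible, all invariants are cycles, and each cycle is homologous to an
invariant. So a homomorphism `φ` between two such Lie algebras sends products of invariants to
products of invariants up to terms on which invariant forms vanish, and `φ` pulls primitive forms
back to primitive forms. For inclusions this says that restriction is well defined.

For the surjectivity, the real part of the complex multilinear extension of a primitive form `β` on
`H` is a primitive form on `ℂ ⊗ H`. If `α` restricts to it, then the pullback of `α` along
`L → ℂ ⊗ L` restricts to `β`.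
-/

namespace RedPair

/-! ### Contractions, derivations and inner products on the exterior algebra -/

section ExteriorCalculus

open CliffordAlgebra (contractLeft contractLeft_ι_mul contractLeft_algebraMap involute involute_ι)
open ExteriorAlgebra (ι algebraMapInv ι_add_mul_swap)

section CommRing

variable {R V W : Type*} [CommRing R] [AddCommGroup V] [Module R V] [AddCommGroup W] [Module R W]

theorem exteriorAlgebra_left_induction {P : ExteriorAlgebra R V → Prop}
    (algebraMap : ∀ r : R, P (algebraMap R _ r)) (add : ∀ x y, P x → P y → P (x + y))
    (ι_mul : ∀ x v, P x → P (ι R v * x)) (w : ExteriorAlgebra R V) : P w :=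
  CliffordAlgebra.left_induction (Q := (0 : QuadraticForm R V)) algebraMap add ι_mul w

theorem mul_ι_eq_ι_mul_involute (w : ExteriorAlgebra R V) (v : V) :
    w * ι R v = ι R v * involute w := by
  induction w using exteriorAlgebra_left_induction with
  | algebraMap r => rw [AlgHom.commutes]; exact Algebra.commutes r _
  | add x y hx hy => rw [add_mul, hx, hy, map_add, mul_add]
  | ι_mul x u hx =>
    rw [map_mul, involute_ι, mul_assoc, hx, ← mul_assoc, ← mul_assoc, mul_neg,
      eq_neg_of_add_eq_zero_left (ι_add_mul_swap u v)]

theorem algebraMapInv_ι_mul (v : V) (w : ExteriorAlgebra R V) :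
    algebraMapInv (ι R v * w) = 0 := by
  simp [algebraMapInv]

theorem algebraMapInv_map (φ : V →ₗ[R] W) (w : ExteriorAlgebra R V) :
    algebraMapInv (ExteriorAlgebra.map φ w) = algebraMapInv w := by
  have h : algebraMapInv.comp (ExteriorAlgebra.map φ) = algebraMapInv := by
    ext v
    simp [algebraMapInv]
  exact DFunLike.congr_fun h w

theorem contractLeft_mem_exteriorPower (d : Module.Dual R V) (k : ℕ) {w : ExteriorAlgebra R V}
    (hw : w ∈ ⋀[R]^k V) : contractLeft d w ∈ ⋀[R]^(k - 1) V := by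
  induction hw using Submodule.pow_induction_on_left' with
  | algebraMap r => rw [contractLeft_algebraMap]; exact zero_mem _
  | add x y i _ _ hx hy => rw [map_add]; exact add_mem hx hy
  | mem_mul v hv i x hx ih =>
    obtain ⟨v, rfl⟩ := hv
    rw [contractLeft_ι_mul]
    refine sub_mem (Submodule.smul_mem _ _ hx) ?_
    cases i with
    | zero =>
      obtain ⟨r, rfl⟩ := Submodule.mem_one.mp hx
      rw [contractLeft_algebraMap, mul_zero]
      exact zero_mem _
    | succ i =>
      rw [Nat.succ_sub_one, ExteriorAlgebra.exteriorPower, pow_succ']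
      exact Submodule.mul_mem_mul (LinearMap.mem_range_self _ _) ih

/-- The bilinear form on `Λ V` induced by a bilinear form `g` on `V`. It is characterized by
`⟨r, w⟩ = r w₀`, with `w₀` the component of `w` in degree `0`, and by
`⟨v ∧ w, w'⟩ = ⟨w, g(v) ⌋ w'⟩`; for symmetric `g` it is
`⟨v₁ ∧ ⋯ ∧ vₖ, w₁ ∧ ⋯ ∧ wₖ⟩ = det (g(vᵢ, wⱼ))`. -/
noncomputable def pairing (g : LinearMap.BilinForm R V) :
    LinearMap.BilinForm R (ExteriorAlgebra R V) :=
  CliffordAlgebra.foldr (0 : QuadraticForm R V) (Module.Dual.transpose ∘ₗ contractLeft ∘ₗ g)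
    (fun v φ => by
      ext w
      simp [Module.Dual.transpose, CliffordAlgebra.contractLeft_contractLeft])
    algebraMapInv.toLinearMap

theorem pairing_algebraMap (g : LinearMap.BilinForm R V) (r : R) (w : ExteriorAlgebra R V) :
    pairing g (algebraMap R _ r) w = r * algebraMapInv w := by
  rw [pairing, CliffordAlgebra.foldr_algebraMap]
  rfl

theorem pairing_ι_mul (g : LinearMap.BilinForm R V) (v : V) (w w' : ExteriorAlgebra R V) :
    pairing g (ι R v * w) w' = pairing g w (contractLeft (g v) w') := by
  rw [pairing, CliffordAlgebra.foldr_mul, CliffordAlgebra.foldr_ι]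
  rfl

variable {g : LinearMap.BilinForm R V}

theorem pairing_ι_mul_right (hg : g.IsSymm) (v : V) (w w' : ExteriorAlgebra R V) :
    pairing g w (ι R v * w') = pairing g (contractLeft (g v) w) w' := by
  induction w using exteriorAlgebra_left_induction generalizing w' with
  | algebraMap r => simp [pairing_algebraMap, contractLeft_algebraMap, algebraMapInv_ι_mul]
  | add x y hx hy => simp only [map_add, LinearMap.add_apply, hx, hy]
  | ι_mul x u hx =>
    simp only [pairing_ι_mul, contractLeft_ι_mul, map_sub, map_smul, hx, LinearMap.sub_apply,
      LinearMap.smul_apply, hg.eq u v]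

theorem pairing_isSymm (hg : g.IsSymm) : (pairing g).IsSymm := by
  refine ⟨fun w w' => ?_⟩
  induction w using exteriorAlgebra_left_induction generalizing w' with
  | algebraMap r =>
    induction w' using exteriorAlgebra_left_induction with
    | algebraMap s => simp [pairing_algebraMap, mul_comm]
    | add x y hx hy => simp only [map_add, LinearMap.add_apply, hx, hy]
    | ι_mul x u _ =>
      simp [pairing_ι_mul, pairing_algebraMap, contractLeft_algebraMap, algebraMapInv_ι_mul]
  | add x y hx hy => simp only [map_add, LinearMap.add_apply, hx, hy]
  | ι_mul x u hx => rw [pairing_ι_mul, pairing_ι_mul_right hg, hx]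

end CommRing

variable {V W : Type*} [AddCommGroup V] [Module ℝ V] [AddCommGroup W] [Module ℝ W]

theorem extDer_algebraMap (f : V →ₗ[ℝ] V) (r : ℝ) : extDer f (algebraMap ℝ _ r) = 0 := by
  rw [Algebra.algebraMap_eq_smul_one, map_smul, extDer_one, smul_zero]

theorem extDer_ι_mul (f : V →ₗ[ℝ] V) (v : V) (w : ExteriorAlgebra ℝ V) :
    extDer f (ι ℝ v * w) = ι ℝ (f v) * w + ι ℝ v * extDer f w := by
  rw [extDer_mul, extDer_ι]

theorem eq_extDer {D : Module.End ℝ (ExteriorAlgebra ℝ V)} {f : V →ₗ[ℝ] V}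
    (h_algebraMap : ∀ r, D (algebraMap ℝ _ r) = 0)
    (h_ι_mul : ∀ v w, D (ι ℝ v * w) = ι ℝ (f v) * w + ι ℝ v * D w) : D = extDer f := by
  refine LinearMap.ext fun w => ?_
  induction w using exteriorAlgebra_left_induction with
  | algebraMap r => rw [h_algebraMap, extDer_algebraMap]
  | add x y hx hy => rw [map_add, map_add, hx, hy]
  | ι_mul x v hx => rw [h_ι_mul, extDer_ι_mul, hx]

theorem algebraMapInv_extDer (f : V →ₗ[ℝ] V) (w : ExteriorAlgebra ℝ V) :
    algebraMapInv (extDer f w) = 0 := by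
  induction w using exteriorAlgebra_left_induction with
  | algebraMap r => rw [extDer_algebraMap, map_zero]
  | add x y hx hy => rw [map_add, map_add, hx, hy, add_zero]
  | ι_mul x v _ => rw [extDer_ι_mul, map_add, algebraMapInv_ι_mul, algebraMapInv_ι_mul, add_zero]

theorem map_extDer {φ : V →ₗ[ℝ] W} {f : V →ₗ[ℝ] V} {g : W →ₗ[ℝ] W}
    (h : ∀ v, φ (f v) = g (φ v)) (w : ExteriorAlgebra ℝ V) :
    ExteriorAlgebra.map φ (extDer f w) = extDer g (ExteriorAlgebra.map φ w) := by
  induction w using exteriorAlgebra_left_induction with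
  | algebraMap r => simp [extDer_algebraMap]
  | add x y hx hy => simp only [map_add, hx, hy]
  | ι_mul x v hx => simp [extDer_ι_mul, hx, h]

theorem involute_extDer (f : V →ₗ[ℝ] V) (w : ExteriorAlgebra ℝ V) :
    involute (extDer f w) = extDer f (involute w) := by
  induction w using exteriorAlgebra_left_induction with
  | algebraMap r => simp [extDer_algebraMap]
  | add x y hx hy => simp only [map_add, hx, hy]
  | ι_mul x v hx => simp [extDer_ι_mul, hx, add_comm]

theorem contractLeft_extDer (d : Module.Dual ℝ V) (f : V →ₗ[ℝ] V) (w : ExteriorAlgebra ℝ V) :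
    contractLeft d (extDer f w) = extDer f (contractLeft d w) + contractLeft (d ∘ₗ f) w := by
  induction w using exteriorAlgebra_left_induction with
  | algebraMap r => simp [extDer_algebraMap, contractLeft_algebraMap]
  | add x y hx hy => simp only [map_add, hx, hy]; abel
  | ι_mul x v hx =>
    simp only [extDer_ι_mul, contractLeft_ι_mul, map_add, map_sub, map_smul, hx, mul_add,
      LinearMap.comp_apply]
    abel

theorem sum_ι_mul_contractLeft_coord {I : Type*} [Fintype I] (b : Module.Basis I ℝ V)
    (f : V →ₗ[ℝ] V) (w : ExteriorAlgebra ℝ V) :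
    ∑ i, ι ℝ (f (b i)) * contractLeft (b.coord i) w = extDer f w := by
  induction w using exteriorAlgebra_left_induction with
  | algebraMap r => simp [contractLeft_algebraMap, extDer_algebraMap]
  | add x y hx hy => simp only [map_add, mul_add, Finset.sum_add_distrib, hx, hy]
  | ι_mul x v hx =>
    have expand : ι ℝ (f v) = ∑ i, b.coord i v • ι ℝ (f (b i)) := by
      conv_lhs => rw [← b.sum_repr v]
      simp only [map_sum, map_smul, Module.Basis.coord_apply]
    have swap (i : I) : ι ℝ (f (b i)) * (ι ℝ v * contractLeft (b.coord i) x) =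
        -(ι ℝ v * (ι ℝ (f (b i)) * contractLeft (b.coord i) x)) := by
      rw [← mul_assoc, ← mul_assoc, eq_neg_of_add_eq_zero_left (ι_add_mul_swap (f (b i)) v),
        neg_mul]
    simp only [contractLeft_ι_mul, mul_sub, swap, sub_neg_eq_add, Finset.sum_add_distrib,
      ← Finset.mul_sum, hx, extDer_ι_mul, expand, Finset.sum_mul, mul_smul_comm, smul_mul_assoc]

theorem extDer_id_of_mem_exteriorPower {k : ℕ} {w : ExteriorAlgebra ℝ V} (hw : w ∈ ⋀[ℝ]^k V) :
    extDer LinearMap.id w = (k : ℝ) • w := by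
  induction hw using Submodule.pow_induction_on_left' with
  | algebraMap r => rw [extDer_algebraMap, Nat.cast_zero, zero_smul]
  | add x y i _ _ hx hy => rw [map_add, hx, hy, smul_add]
  | mem_mul v hv i x _ hx =>
    obtain ⟨v, rfl⟩ := hv
    rw [extDer_ι_mul, hx, LinearMap.id_apply, Nat.cast_succ, add_smul, one_smul, add_comm,
      mul_smul_comm]

section Pairing

variable {g : LinearMap.BilinForm ℝ V}

theorem pairing_extDer {f f' : V →ₗ[ℝ] V} (hf : ∀ x y, g (f x) y = g x (f' y))
    (w w' : ExteriorAlgebra ℝ V) :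
    pairing g (extDer f w) w' = pairing g w (extDer f' w') := by
  induction w using exteriorAlgebra_left_induction generalizing w' with
  | algebraMap r => simp [pairing_algebraMap, extDer_algebraMap, algebraMapInv_extDer]
  | add x y hx hy => simp only [map_add, LinearMap.add_apply, hx, hy]
  | ι_mul x u hx =>
    have adjoint : g u ∘ₗ f' = g (f u) := LinearMap.ext fun y => (hf u y).symm
    rw [extDer_ι_mul, map_add, LinearMap.add_apply, pairing_ι_mul, pairing_ι_mul, pairing_ι_mul,
      hx, contractLeft_extDer, map_add, adjoint, add_comm]

theorem pairing_eq_zero_of_mem_exteriorPower {j k : ℕ} (hjk : j ≠ k)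
    {u w : ExteriorAlgebra ℝ V} (hu : u ∈ ⋀[ℝ]^j V) (hw : w ∈ ⋀[ℝ]^k V) :
    pairing g u w = 0 := by
  have h := pairing_extDer (g := g) (f := LinearMap.id) (f' := LinearMap.id) (fun _ _ => rfl) u w
  rw [extDer_id_of_mem_exteriorPower hu, extDer_id_of_mem_exteriorPower hw, map_smul, map_smul,
    LinearMap.smul_apply, smul_eq_mul, smul_eq_mul, ← sub_eq_zero, ← sub_mul] at h
  exact (mul_eq_zero.mp h).resolve_left (sub_ne_zero.mpr (by exact_mod_cast hjk))

theorem pairing_extDer_id_self {I : Type*} [Fintype I] {b : Module.Basis I ℝ V}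
    (hb : g.IsOrthoᵢ b) (w : ExteriorAlgebra ℝ V) :
    pairing g (extDer LinearMap.id w) w =
      ∑ i, g (b i) (b i) * pairing g (contractLeft (b.coord i) w) (contractLeft (b.coord i) w) := by
  classical
  have dual (i : I) : g (b i) = g (b i) (b i) • b.coord i := b.ext fun j => by
    rcases eq_or_ne i j with rfl | hij
    · simp
    · simpa [hij.symm] using hb hij
  rw [← sum_ι_mul_contractLeft_coord b LinearMap.id w, map_sum, LinearMap.sum_apply]
  refine Finset.sum_congr rfl fun i _ => ?_
  rw [pairing_ι_mul, LinearMap.id_apply, dual i]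
  simp only [map_smul, LinearMap.smul_apply, smul_eq_mul, Module.Basis.coord_apply,
    Module.Basis.repr_self, Finsupp.single_eq_same, mul_one]

variable [FiniteDimensional ℝ V]

-- `extDer id` is multiplication by the degree, and in an orthogonal basis it reduces `⟨w, w⟩` to
-- the contractions of `w`, which have smaller degree.
theorem pairing_self_pos_of_mem_exteriorPower (hg : g.IsSymm) (hpos : ∀ x, x ≠ 0 → 0 < g x x)
    (k : ℕ) {w : ExteriorAlgebra ℝ V} (hw : w ∈ ⋀[ℝ]^k V) (hw0 : w ≠ 0) : 0 < pairing g w w := by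
  obtain ⟨b, hb⟩ := LinearMap.BilinForm.exists_orthogonal_basis
    (LinearMap.BilinForm.isSymm_iff.mp hg)
  induction k generalizing w with
  | zero =>
    obtain ⟨r, rfl⟩ := Submodule.mem_one.mp hw
    have hr : r ≠ 0 := by
      rintro rfl
      simp at hw0
    simpa [pairing_algebraMap] using hr
  | succ k ih =>
    have hb_pos (i) : 0 < g (b i) (b i) := hpos _ (b.ne_zero i)
    have contraction_pos (i) (hi : contractLeft (b.coord i) w ≠ 0) :=
      mul_pos (hb_pos i) (ih (contractLeft_mem_exteriorPower (b.coord i) (k + 1) hw) hi)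
    have expansion := pairing_extDer_id_self hb w
    rw [extDer_id_of_mem_exteriorPower hw, map_smul, LinearMap.smul_apply, smul_eq_mul]
      at expansion
    refine pos_of_mul_pos_right (expansion ▸ ?_) (Nat.cast_nonneg (k + 1))
    refine Finset.sum_pos' (fun i _ => ?_) ?_
    · rcases eq_or_ne (contractLeft (b.coord i) w) 0 with h | h
      · simp [h]
      · exact (contraction_pos i h).le
    · by_contra! h
      have contraction_eq_zero (i) : contractLeft (b.coord i) w = 0 := by
        by_contra hi
        exact (contraction_pos i hi).not_ge (h i (Finset.mem_univ i))
      have hD := sum_ι_mul_contractLeft_coord b LinearMap.id w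
      rw [extDer_id_of_mem_exteriorPower hw] at hD
      simp only [contraction_eq_zero, mul_zero, Finset.sum_const_zero] at hD
      exact hw0 ((smul_eq_zero.mp hD.symm).resolve_left (by positivity))

theorem pairing_self_pos (hg : g.IsSymm) (hpos : ∀ x, x ≠ 0 → 0 < g x x)
    {w : ExteriorAlgebra ℝ V} (hw : w ≠ 0) : 0 < pairing g w w := by
  classical
  let component := DirectSum.decompose (fun i : ℕ => ⋀[ℝ]^i V) w
  have sum_component : ∑ i ∈ component.support, (component i : ExteriorAlgebra ℝ V) = w :=
    DirectSum.sum_support_decompose _ w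
  have orthogonal_expansion :
      pairing g w w = ∑ i ∈ component.support, pairing g (component i) (component i) := by
    conv_lhs => rw [← sum_component]
    rw [map_sum]
    refine Finset.sum_congr rfl fun i hi => ?_
    rw [map_sum, LinearMap.sum_apply]
    exact Finset.sum_eq_single_of_mem i hi fun j _ hj =>
      pairing_eq_zero_of_mem_exteriorPower hj (component j).2 (component i).2
  rw [orthogonal_expansion]
  refine Finset.sum_pos (fun i hi => ?_) (Finset.nonempty_iff_ne_empty.mpr fun h => hw ?_)
  · exact pairing_self_pos_of_mem_exteriorPower hg hpos i (component i).2
      (by simpa using DFinsupp.mem_support_iff.mp hi)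
  · rw [← sum_component, h, Finset.sum_empty]

end Pairing

end ExteriorCalculus

/-! ### Homology and invariants of reductive Lie algebras -/

section CompleteReducibility

variable {K M X : Type*} [Field K] [AddCommGroup M] [Module K M]
  {b : LinearMap.BilinForm K M} {T : X → Module.End K M}

theorem disjoint_iInf_ker_iSup_range (hb : ∀ m, b m m = 0 → m = 0)
    (hT : ∀ x, ∃ y, ∀ m n, b (T x m) n = b m (T y n)) :
    Disjoint (⨅ x, LinearMap.ker (T x)) (⨆ x, LinearMap.range (T x)) := by
  rw [Submodule.disjoint_def]
  intro m hm hm'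
  suffices h : ⨆ x, LinearMap.range (T x) ≤ LinearMap.ker (b.flip m) from hb m (h hm')
  refine iSup_le fun x => ?_
  rintro _ ⟨n, rfl⟩
  obtain ⟨y, hy⟩ := hT x
  have hTm : T y m = 0 := (Submodule.mem_iInf _).mp hm y
  rw [LinearMap.mem_ker, LinearMap.BilinForm.flip_apply, hy, hTm, map_zero]

theorem le_inf_iInf_ker_sup_iSup_map [FiniteDimensional K M] (hb_refl : b.IsRefl)
    (hb : ∀ m, b m m = 0 → m = 0) (hT : ∀ x, ∃ y, ∀ m n, b (T x m) n = b m (T y n))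
    {W : Submodule K M} (hW : ∀ x, W.map (T x) ≤ W) :
    W ≤ (W ⊓ ⨅ x, LinearMap.ker (T x)) ⊔ ⨆ x, W.map (T x) := by
  set S := ⨆ x, W.map (T x)
  have hSW : S ≤ W := iSup_le hW
  have map_mem (x) {w} (hw : w ∈ W) : T x w ∈ S :=
    Submodule.mem_iSup_of_mem x (Submodule.mem_map_of_mem hw)
  have disjoint : Disjoint S (b.orthogonal S) :=
    Submodule.disjoint_def.mpr fun s hs hs' => hb s (hs' s hs)
  have isCompl := (LinearMap.BilinForm.isCompl_orthogonal_iff_disjoint hb_refl).mpr disjoint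
  intro w hw
  obtain ⟨s, hs, t, ht, rfl⟩ := Submodule.mem_sup.mp
    (isCompl.sup_eq_top ▸ Submodule.mem_top (x := w))
  have htW : t ∈ W := (W.add_mem_iff_right (hSW hs)).mp hw
  have ht_ker (x) : T x t = 0 := by
    obtain ⟨y, hy⟩ := hT x
    refine hb _ ?_
    rw [hy]
    exact hb_refl _ _ (ht _ (map_mem y (hSW (map_mem x htW))))
  rw [add_comm]
  exact Submodule.add_mem_sup ⟨htW, (Submodule.mem_iInf _).mpr ht_ker⟩ hs

end CompleteReducibility

section Boundary

open CliffordAlgebra (involute involute_ι involute_involute)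
open ExteriorAlgebra (ι algebraMapInv)

attribute [local instance] LieRing.ofAssociativeRing

/-- The action of `𝔤𝔩(V)` on `Λ V` by derivations. -/
noncomputable def extDerHom (V : Type*) [AddCommGroup V] [Module ℝ V] :
    Module.End ℝ V →ₗ⁅ℝ⁆ Module.End ℝ (ExteriorAlgebra ℝ V) where
  toFun := extDer
  map_add' f g := (eq_extDer (by simp [extDer_algebraMap]) fun v w => by
    simp only [LinearMap.add_apply, extDer_ι_mul, map_add]
    noncomm_ring).symm
  map_smul' c f := (eq_extDer (by simp [extDer_algebraMap]) fun v w => by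
    simp [extDer_ι_mul]).symm
  map_lie' {f g} := (eq_extDer (by simp [extDer_algebraMap, LieRing.of_associative_ring_bracket])
    fun v w => by
      simp only [LieRing.of_associative_ring_bracket, LinearMap.sub_apply, Module.End.mul_apply,
        extDer_ι_mul, map_add, map_sub]
      noncomm_ring).symm

variable {L H : Type*} [LieRing L] [LieAlgebra ℝ L] [LieRing H] [LieAlgebra ℝ H]

/-- The action of `L` on `Λ L` that is induced by the adjoint action. -/
noncomputable def lieDer : L →ₗ⁅ℝ⁆ Module.End ℝ (ExteriorAlgebra ℝ L) :=
  (extDerHom L).comp (LieAlgebra.ad ℝ L)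

theorem lieDer_algebraMap (x : L) (r : ℝ) : lieDer x (algebraMap ℝ _ r) = 0 :=
  extDer_algebraMap _ r

theorem lieDer_mul (x : L) (u w : ExteriorAlgebra ℝ L) :
    lieDer x (u * w) = lieDer x u * w + u * lieDer x w :=
  extDer_mul _ u w

theorem lieDer_ι_mul (x v : L) (w : ExteriorAlgebra ℝ L) :
    lieDer x (ι ℝ v * w) = ι ℝ ⁅x, v⁆ * w + ι ℝ v * lieDer x w :=
  extDer_ι_mul _ v w

theorem involute_lieDer (x : L) (w : ExteriorAlgebra ℝ L) :
    involute (lieDer x w) = lieDer x (involute w) :=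
  involute_extDer _ w

theorem map_lieDer (φ : H →ₗ⁅ℝ⁆ L) (x : H) (w : ExteriorAlgebra ℝ H) :
    ExteriorAlgebra.map (φ : H →ₗ[ℝ] L) (lieDer x w) =
      lieDer (φ x) (ExteriorAlgebra.map (φ : H →ₗ[ℝ] L) w) :=
  map_extDer (φ.map_lie x) w

/-- The boundary operator of the Lie algebra homology complex on `Λ L`,
`∂(x₁ ∧ ⋯ ∧ xₖ) = ∑_{i < j} (-1)^{i+j+1} ⁅xᵢ, xⱼ⁆ ∧ x₁ ∧ ⋯ ∧ x̂ᵢ ∧ ⋯ ∧ x̂ⱼ ∧ ⋯ ∧ xₖ`, defined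
recursively by `∂(x ∧ w) = x · w - x ∧ ∂w`. -/
noncomputable def boundary (L : Type*) [LieRing L] [LieAlgebra ℝ L] :
    Module.End ℝ (ExteriorAlgebra ℝ L) :=
  CliffordAlgebra.foldr' (0 : QuadraticForm ℝ L)
    (LinearMap.mk₂ ℝ (fun x p => lieDer x p.1 - ι ℝ x * p.2)
      (fun x y p => by simp only [map_add, LinearMap.add_apply, add_mul]; abel)
      (fun c x p => by simp [smul_sub])
      (fun x p q => by simp only [Prod.fst_add, Prod.snd_add, map_add, mul_add]; abel)
      (fun c x p => by simp [smul_sub]))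
    (fun x w w' => by
      simp [lieDer_ι_mul, mul_sub, ← mul_assoc])
    0

theorem boundary_algebraMap (r : ℝ) : boundary L (algebraMap ℝ _ r) = 0 := by
  rw [boundary, CliffordAlgebra.foldr'_algebraMap, smul_zero]

theorem boundary_ι_mul (x : L) (w : ExteriorAlgebra ℝ L) :
    boundary L (ι ℝ x * w) = lieDer x w - ι ℝ x * boundary L w :=
  CliffordAlgebra.foldr'_ι_mul _ _ _ _ _ _

theorem boundary_lieDer (x : L) (w : ExteriorAlgebra ℝ L) :
    boundary L (lieDer x w) = lieDer x (boundary L w) := by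
  induction w using exteriorAlgebra_left_induction with
  | algebraMap r => simp only [lieDer_algebraMap, boundary_algebraMap, map_zero]
  | add u w hu hw => simp only [map_add, hu, hw]
  | ι_mul w v hw =>
    simp only [lieDer_ι_mul, boundary_ι_mul, map_add, map_sub, hw, LieHom.map_lie,
      LieRing.of_associative_ring_bracket, LinearMap.sub_apply, Module.End.mul_apply]
    abel

theorem boundary_involute (w : ExteriorAlgebra ℝ L) :
    boundary L (involute w) = -involute (boundary L w) := by
  induction w using exteriorAlgebra_left_induction with
  | algebraMap r => simp [boundary_algebraMap]
  | add u w hu hw => rw [map_add, map_add, hu, hw, map_add, map_add, neg_add]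
  | ι_mul w v hw =>
    rw [map_mul, involute_ι, neg_mul, map_neg, boundary_ι_mul, boundary_ι_mul, hw, map_sub,
      map_mul, involute_ι, involute_lieDer, neg_mul, mul_neg]

theorem boundary_mul_ι (w : ExteriorAlgebra ℝ L) (x : L) :
    boundary L (w * ι ℝ x) = lieDer x (involute w) + boundary L w * ι ℝ x := by
  rw [mul_ι_eq_ι_mul_involute, boundary_ι_mul, boundary_involute, mul_neg, sub_neg_eq_add,
    mul_ι_eq_ι_mul_involute]

theorem map_boundary (φ : H →ₗ⁅ℝ⁆ L) (w : ExteriorAlgebra ℝ H) :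
    ExteriorAlgebra.map (φ : H →ₗ[ℝ] L) (boundary H w) =
      boundary L (ExteriorAlgebra.map (φ : H →ₗ[ℝ] L) w) := by
  induction w using exteriorAlgebra_left_induction with
  | algebraMap r => simp [boundary_algebraMap]
  | add u w hu hw => simp only [map_add, hu, hw]
  | ι_mul w v hw =>
    rw [boundary_ι_mul, map_sub, map_mul, map_mul, map_lieDer, ExteriorAlgebra.map_apply_ι, hw,
      boundary_ι_mul]
    rfl

section InvariantForm

variable {N : Type*} [AddCommGroup N] [Module ℝ N] {F : ExteriorAlgebra ℝ L →ₗ[ℝ] N}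

-- In `∂(u w) = ∂u w + û ∂w + ⟦u, w⟧` with `û = involute u`, the invariance of `F` turns the
-- Schouten bracket `⟦u, w⟧` into `-2 û ∂w`.
theorem invariant_boundary_mul_eq_sub (hF : ∀ x w, F (lieDer x w) = 0)
    (u w : ExteriorAlgebra ℝ L) :
    F (boundary L (u * w)) = F (boundary L u * w) - F (involute u * boundary L w) := by
  induction w using exteriorAlgebra_left_induction generalizing u with
  | algebraMap r => simp [boundary_algebraMap, ← Algebra.commutes r, ← Algebra.smul_def]
  | add w w' hw hw' => simp only [mul_add, map_add, hw, hw']; abel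
  | ι_mul w x hw =>
    have invariance := hF x (involute u * w)
    rw [lieDer_mul, map_add] at invariance
    rw [← mul_assoc, hw, boundary_mul_ι, boundary_ι_mul, map_mul involute, involute_ι, add_mul,
      mul_sub, map_add, map_sub, eq_neg_of_add_eq_zero_left invariance, mul_assoc, mul_assoc,
      neg_mul, mul_neg, map_neg]
    abel

theorem invariant_boundary (hF : ∀ x w, F (lieDer x w) = 0) (w : ExteriorAlgebra ℝ L) :
    F (boundary L w) = 0 := by
  have boundary_one : boundary L 1 = 0 := by
    rw [← map_one (algebraMap ℝ (ExteriorAlgebra ℝ L)), boundary_algebraMap]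
  have h := invariant_boundary_mul_eq_sub hF 1 w
  rw [boundary_one, map_one, one_mul, one_mul, zero_mul, map_zero, zero_sub] at h
  linear_combination (norm := module) (2⁻¹ : ℝ) • h

theorem invariant_boundary_mul (hF : ∀ x w, F (lieDer x w) = 0) {w : ExteriorAlgebra ℝ L}
    (hw : boundary L w = 0) (u : ExteriorAlgebra ℝ L) : F (boundary L u * w) = 0 := by
  have h := invariant_boundary_mul_eq_sub hF u w
  rw [invariant_boundary hF, hw, mul_zero, map_zero, sub_zero] at h
  exact h.symm

theorem invariant_mul_boundary (hF : ∀ x w, F (lieDer x w) = 0) {u : ExteriorAlgebra ℝ L}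
    (hu : boundary L u = 0) (w : ExteriorAlgebra ℝ L) : F (u * boundary L w) = 0 := by
  have h := invariant_boundary_mul_eq_sub hF (involute u) w
  rw [invariant_boundary hF, boundary_involute, hu, map_zero, neg_zero, zero_mul, map_zero,
    zero_sub, involute_involute] at h
  exact neg_eq_zero.mp h.symm

end InvariantForm

theorem algebraMapInv_boundary (w : ExteriorAlgebra ℝ L) : algebraMapInv (boundary L w) = 0 :=
  invariant_boundary (F := algebraMapInv.toLinearMap) (fun _ => algebraMapInv_extDer _) w

theorem range_boundary_le :
    LinearMap.range (boundary L) ≤ ⨆ x : L, LinearMap.range (lieDer x) := by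
  rintro _ ⟨w, rfl⟩
  rw [← Submodule.Quotient.mk_eq_zero, ← Submodule.mkQ_apply]
  refine invariant_boundary (fun x w => ?_) w
  rw [Submodule.mkQ_apply, Submodule.Quotient.mk_eq_zero]
  exact Submodule.mem_iSup_of_mem x (LinearMap.mem_range_self _ w)

end Boundary

section Reductive

open ExteriorAlgebra (algebraMapInv)

variable {L : Type*} [LieRing L] [LieAlgebra ℝ L]

/-- The space `(Λ L)^L` of invariants in all degrees. -/
noncomputable def invariants (L : Type*) [LieRing L] [LieAlgebra ℝ L] :
    Submodule ℝ (ExteriorAlgebra ℝ L) :=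
  ⨅ x : L, LinearMap.ker (lieDer x)

theorem mem_posInvariants_iff {w : ExteriorAlgebra ℝ L} :
    w ∈ posInvariants L ↔ algebraMapInv w = 0 ∧ w ∈ invariants L := by
  simp only [invariants, Submodule.mem_iInf, LinearMap.mem_ker]
  rfl

instance finiteDimensional_exteriorAlgebra {V : Type*} [AddCommGroup V] [Module ℝ V]
    [FiniteDimensional ℝ V] : FiniteDimensional ℝ (ExteriorAlgebra ℝ V) :=
  Module.Finite.of_basis (Module.finBasis ℝ V).ExteriorAlgebra

variable [FiniteDimensional ℝ L] {θ : L →ₗ⁅ℝ⁆ L}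

theorem IsCartanInvolution.exists_innerProduct (hθ : IsCartanInvolution θ) :
    ∃ b : LinearMap.BilinForm ℝ (ExteriorAlgebra ℝ L), b.IsSymm ∧ (∀ w, b w w = 0 → w = 0) ∧
      ∀ x w w', b (lieDer x w) w' = b w (lieDer (-θ x) w') := by
  obtain ⟨B, hsymm, hinv, hB, hneg⟩ := hθ.exists_form
  let g : LinearMap.BilinForm ℝ L := -B.compl₂ (θ : L →ₗ[ℝ] L)
  have g_apply (x y) : g x y = -B x (θ y) := rfl
  have g_symm : g.IsSymm := ⟨fun x y => by
    rw [g_apply, g_apply, ← hB x, hθ.involutive, hsymm]⟩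
  have g_pos (x) (hx : x ≠ 0) : 0 < g x x := neg_pos.mpr (hneg x hx)
  have g_lie (x y z) : g ⁅x, y⁆ z = g y ⁅-θ x, z⁆ := by
    rw [g_apply, g_apply, ← lie_skew, neg_lie, map_neg, map_neg, map_neg, LieHom.map_lie,
      hθ.involutive, LinearMap.neg_apply, hinv]
  refine ⟨pairing g, pairing_isSymm g_symm, fun w hw => ?_, fun x => pairing_extDer (g_lie x)⟩
  by_contra h
  exact (pairing_self_pos g_symm g_pos h).ne' hw

theorem IsCartanInvolution.invariants_le_ker_boundary (hθ : IsCartanInvolution θ) :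
    invariants L ≤ LinearMap.ker (boundary L) := by
  obtain ⟨b, -, hb, adjoint⟩ := hθ.exists_innerProduct
  have disjoint := disjoint_iInf_ker_iSup_range (T := lieDer) hb fun x => ⟨_, adjoint x⟩
  intro w hw
  refine Submodule.disjoint_def.mp disjoint _ ?_ (range_boundary_le ⟨w, rfl⟩)
  simp only [invariants, Submodule.mem_iInf, LinearMap.mem_ker] at hw ⊢
  intro x
  rw [← boundary_lieDer, hw, map_zero]

theorem IsCartanInvolution.ker_boundary_le (hθ : IsCartanInvolution θ) :
    LinearMap.ker (boundary L) ≤ invariants L ⊔ LinearMap.range (boundary L) := by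
  obtain ⟨b, b_symm, hb, adjoint⟩ := hθ.exists_innerProduct
  have stable (x : L) : (LinearMap.ker (boundary L)).map (lieDer x) ≤
      LinearMap.ker (boundary L) := by
    rintro _ ⟨w, hw, rfl⟩
    rw [LinearMap.mem_ker, boundary_lieDer, hw, map_zero]
  refine (le_inf_iInf_ker_sup_iSup_map b_symm.isRefl hb (fun x => ⟨_, adjoint x⟩) stable).trans
    (sup_le_sup inf_le_right (iSup_le fun x => ?_))
  rintro _ ⟨w, hw, rfl⟩
  refine ⟨ExteriorAlgebra.ι ℝ x * w, ?_⟩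
  rw [boundary_ι_mul, hw, mul_zero, sub_zero]

end Reductive

section Pullback

open ExteriorAlgebra (algebraMapInv)

variable {G H L : Type*} [LieRing G] [LieAlgebra ℝ G] [LieRing H] [LieAlgebra ℝ H]
  [LieRing L] [LieAlgebra ℝ L]

/-- The map `Λ L^* → Λ H^*` induced by a homomorphism `H → L`, with alternating forms viewed as
linear forms on the exterior algebra. -/
noncomputable def pullback (φ : H →ₗ⁅ℝ⁆ L) :
    Module.Dual ℝ (ExteriorAlgebra ℝ L) →ₗ[ℝ] Module.Dual ℝ (ExteriorAlgebra ℝ H) :=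
  Module.Dual.transpose (R := ℝ) (ExteriorAlgebra.map (φ : H →ₗ[ℝ] L)).toLinearMap

theorem pullback_apply (φ : H →ₗ⁅ℝ⁆ L) (α : Module.Dual ℝ (ExteriorAlgebra ℝ L))
    (w : ExteriorAlgebra ℝ H) :
    pullback φ α w = α (ExteriorAlgebra.map (φ : H →ₗ[ℝ] L) w) :=
  rfl

theorem rest_eq_pullback (K : LieSubalgebra ℝ L) : rest K = pullback K.incl :=
  rfl

theorem pullback_pullback (ψ : G →ₗ⁅ℝ⁆ H) (φ : H →ₗ⁅ℝ⁆ L)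
    (α : Module.Dual ℝ (ExteriorAlgebra ℝ L)) :
    pullback ψ (pullback φ α) = pullback (φ.comp ψ) α := by
  refine LinearMap.ext fun w => congrArg α ?_
  exact DFunLike.congr_fun (ExteriorAlgebra.map_comp_map (ψ : G →ₗ[ℝ] H) (φ : H →ₗ[ℝ] L)) w

variable [FiniteDimensional ℝ H] [FiniteDimensional ℝ L] {θH : H →ₗ⁅ℝ⁆ H} {θL : L →ₗ⁅ℝ⁆ L}

theorem exists_map_eq_add_boundary (hθH : IsCartanInvolution θH) (hθL : IsCartanInvolution θL)
    (φ : H →ₗ⁅ℝ⁆ L) {w : ExteriorAlgebra ℝ H} (hw : w ∈ posInvariants H) :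
    ∃ u ∈ posInvariants L, ∃ a,
      ExteriorAlgebra.map (φ : H →ₗ[ℝ] L) w = u + boundary L a := by
  rw [mem_posInvariants_iff] at hw
  have cycle : boundary L (ExteriorAlgebra.map (φ : H →ₗ[ℝ] L) w) = 0 := by
    rw [← map_boundary, hθH.invariants_le_ker_boundary hw.2, map_zero]
  obtain ⟨u, hu, _, ⟨a, rfl⟩, hua⟩ := Submodule.mem_sup.mp (hθL.ker_boundary_le cycle)
  refine ⟨u, mem_posInvariants_iff.mpr ⟨?_, hu⟩, a, hua.symm⟩
  rw [eq_sub_of_add_eq hua, map_sub, algebraMapInv_map, hw.1, algebraMapInv_boundary, sub_zero]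

theorem pullback_mem_primitive (hθH : IsCartanInvolution θH) (hθL : IsCartanInvolution θL)
    (φ : H →ₗ⁅ℝ⁆ L) {α : Module.Dual ℝ (ExteriorAlgebra ℝ L)} (hα : α ∈ primitive L) :
    pullback φ α ∈ primitive H := by
  obtain ⟨hα_one, hα_inv, hα_mul⟩ := hα
  refine ⟨?_, fun x w => ?_, fun u hu w hw => ?_⟩
  · rw [pullback_apply, map_one, hα_one]
  · exact (congrArg α (map_lieDer φ x w)).trans (hα_inv _ _)
  · obtain ⟨u', hu', a, ha⟩ := exists_map_eq_add_boundary hθH hθL φ hu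
    obtain ⟨w', hw', c, hc⟩ := exists_map_eq_add_boundary hθH hθL φ hw
    have cycle : boundary L (ExteriorAlgebra.map (φ : H →ₗ[ℝ] L) w) = 0 := by
      rw [← map_boundary, hθH.invariants_le_ker_boundary (mem_posInvariants_iff.mp hw).2, map_zero]
    have cycle' : boundary L u' = 0 :=
      hθL.invariants_le_ker_boundary (mem_posInvariants_iff.mp hu').2
    rw [pullback_apply, map_mul, ha, add_mul, map_add, invariant_boundary_mul hα_inv cycle, hc,
      mul_add, map_add, invariant_mul_boundary hα_inv cycle', hα_mul u' hu' w' hw', add_zero,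
      add_zero]

theorem pullback_mem_primitiveAnti (hθH : IsCartanInvolution θH) (hθL : IsCartanInvolution θL)
    {φ : H →ₗ⁅ℝ⁆ L} (hφ : ∀ x, φ (θH x) = θL (φ x)) {α : Module.Dual ℝ (ExteriorAlgebra ℝ L)}
    (hα : α ∈ primitiveAnti (θL : L →ₗ[ℝ] L)) :
    pullback φ α ∈ primitiveAnti (θH : H →ₗ[ℝ] H) := by
  refine ⟨pullback_mem_primitive hθH hθL φ hα.1, fun w => ?_⟩
  have hφ' : φ.comp θH = θL.comp φ := LieHom.ext hφ
  have comm := congrArg (pullback · α w) hφ'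
  simp only [← pullback_pullback] at comm
  exact comm.trans (hα.2 _)

end Pullback

/-! ### Complexification -/

section BaseChange

open ExteriorAlgebra (ι algebraMapInv)

section Slice

variable {R A B M N : Type*} [CommRing R] [AddCommGroup A] [Module R A] [AddCommGroup B]
  [Module R B] [AddCommGroup M] [Module R M] [AddCommGroup N] [Module R N]

/-- The slice map `z ⊗ m ↦ l(z) m` defined by a linear form `l` on `A`. For `A = ℂ` the forms
`Re` and `Im` give the real and the imaginary part. -/
noncomputable def slice (l : Module.Dual R A) : A ⊗[R] M →ₗ[R] M :=
  TensorProduct.lid R M ∘ₗ l.rTensor M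

theorem slice_tmul (l : Module.Dual R A) (z : A) (m : M) : slice l (z ⊗ₜ[R] m) = l z • m :=
  rfl

theorem slice_map (l : Module.Dual R B) (g : A →ₗ[R] B) (f : M →ₗ[R] N) (t : A ⊗[R] M) :
    slice l (TensorProduct.map g f t) = f (slice (l ∘ₗ g) t) := by
  induction t with
  | zero => simp only [map_zero]
  | tmul z m => simp [slice_tmul]
  | add s t hs ht => simp only [map_add, hs, ht]

theorem slice_reLm_mul {E : Type*} [Ring E] [Algebra ℝ E] (s t : ℂ ⊗[ℝ] E) :
    slice Complex.reLm (s * t) =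
      slice Complex.reLm s * slice Complex.reLm t -
        slice Complex.imLm s * slice Complex.imLm t := by
  induction s with
  | zero => simp
  | add s s' hs hs' => simp only [add_mul, map_add, hs, hs']; abel
  | tmul z x =>
    induction t with
    | zero => simp
    | add t t' ht ht' => simp only [mul_add, map_add, ht, ht']; abel
    | tmul z' y => 
      simp only [Algebra.TensorProduct.tmul_mul_tmul, slice_tmul, Complex.reLm_coe,
        Complex.imLm_coe, Complex.mul_re, sub_smul, smul_mul_smul_comm]

end Slice

section BaseChangeExterior

variable {R A B V W : Type*} [CommRing R] [CommRing A] [Algebra R A] [CommRing B] [Algebra R B]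
  [AddCommGroup V] [Module R V] [AddCommGroup W] [Module R W]

theorem lTensor_ι_mul_swap (v w : A ⊗[R] V) :
    (ι R).lTensor A v * (ι R).lTensor A w + (ι R).lTensor A w * (ι R).lTensor A v = 0 := by
  induction v with
  | zero => simp
  | add v v' hv hv' => rw [map_add, mul_add, add_mul, add_add_add_comm, hv, hv', add_zero]
  | tmul a x =>
    induction w with
    | zero => simp
    | add w w' hw hw' => rw [map_add, mul_add, add_mul, add_add_add_comm, hw, hw', add_zero]
    | tmul b y =>
      rw [LinearMap.lTensor_tmul, LinearMap.lTensor_tmul, Algebra.TensorProduct.tmul_mul_tmul,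
        Algebra.TensorProduct.tmul_mul_tmul, mul_comm b a, ← TensorProduct.tmul_add,
        ExteriorAlgebra.ι_add_mul_swap, TensorProduct.tmul_zero]

theorem lTensor_ι_mul_self (v : A ⊗[R] V) :
    (ι R).lTensor A v * (ι R).lTensor A v = 0 := by
  induction v with
  | zero => simp
  | tmul a x => simp
  | add v w hv hw =>
    rw [map_add, add_mul, mul_add, mul_add, hv, hw, zero_add, add_zero, lTensor_ι_mul_swap]

/-- The canonical homomorphism from the exterior algebra of `A ⊗ V` over `R` to `A ⊗ Λ V`, which is
the exterior algebra of `A ⊗ V` over `A`. -/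
noncomputable def exteriorBaseChange :
    ExteriorAlgebra R (A ⊗[R] V) →ₐ[R] A ⊗[R] ExteriorAlgebra R V :=
  ExteriorAlgebra.lift R ⟨(ι R).lTensor A, lTensor_ι_mul_self⟩

theorem exteriorBaseChange_ι (v : A ⊗[R] V) :
    exteriorBaseChange (ι R v) = (ι R).lTensor A v :=
  ExteriorAlgebra.lift_ι_apply R _ lTensor_ι_mul_self v

theorem lTensor_algebraMapInv_exteriorBaseChange (w : ExteriorAlgebra R (A ⊗[R] V)) :
    algebraMapInv.toLinearMap.lTensor A (exteriorBaseChange w) =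
      algebraMap R (A ⊗[R] R) (algebraMapInv w) := by
  have h : (Algebra.TensorProduct.map (AlgHom.id R A) algebraMapInv).comp exteriorBaseChange =
      (Algebra.ofId R (A ⊗[R] R)).comp (algebraMapInv (M := A ⊗[R] V)) := by
    ext a x
    simp [exteriorBaseChange_ι, algebraMapInv]
  exact DFunLike.congr_fun h w

theorem exteriorBaseChange_map (g : A →ₐ[R] B) (f : V →ₗ[R] W)
    (w : ExteriorAlgebra R (A ⊗[R] V)) :
    exteriorBaseChange (ExteriorAlgebra.map (TensorProduct.map g.toLinearMap f) w) =
      TensorProduct.map g.toLinearMap (ExteriorAlgebra.map f).toLinearMap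
        (exteriorBaseChange w) := by
  have h : exteriorBaseChange.comp (ExteriorAlgebra.map (TensorProduct.map g.toLinearMap f)) =
      (Algebra.TensorProduct.map g (ExteriorAlgebra.map f)).comp exteriorBaseChange := by
    ext a x
    simp [exteriorBaseChange_ι]
  exact DFunLike.congr_fun h w

theorem exteriorBaseChange_map_one_tmul (w : ExteriorAlgebra R V) :
    exteriorBaseChange (ExteriorAlgebra.map (TensorProduct.mk R A V 1) w) = 1 ⊗ₜ[R] w := by
  have h : exteriorBaseChange.comp (ExteriorAlgebra.map (TensorProduct.mk R A V 1)) =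
      Algebra.TensorProduct.includeRight := by
    ext x
    simp [exteriorBaseChange_ι]
  exact DFunLike.congr_fun h w

end BaseChangeExterior

section Derivation

variable {A V : Type*} [CommRing A] [Algebra ℝ A] [AddCommGroup V] [Module ℝ V]

theorem map_mulLeft_extDer_mul (z : A) (f : V →ₗ[ℝ] V) (s t : A ⊗[ℝ] ExteriorAlgebra ℝ V) :
    TensorProduct.map (LinearMap.mulLeft ℝ z) (extDer f) (s * t) =
      TensorProduct.map (LinearMap.mulLeft ℝ z) (extDer f) s * t +
        s * TensorProduct.map (LinearMap.mulLeft ℝ z) (extDer f) t := by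
  induction s with
  | zero => simp
  | add s s' hs hs' => simp only [add_mul, map_add, hs, hs']; abel
  | tmul a u =>
    induction t with
    | zero => simp
    | add t t' ht ht' => simp only [mul_add, map_add, ht, ht']; abel
    | tmul b w =>
      simp only [Algebra.TensorProduct.tmul_mul_tmul, TensorProduct.map_tmul,
        LinearMap.mulLeft_apply, extDer_mul, TensorProduct.tmul_add, mul_assoc,
        mul_left_comm a z b]

theorem exteriorBaseChange_extDer (z : A) (f : V →ₗ[ℝ] V)
    (w : ExteriorAlgebra ℝ (A ⊗[ℝ] V)) :
    exteriorBaseChange (extDer (TensorProduct.map (LinearMap.mulLeft ℝ z) f) w) =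
      TensorProduct.map (LinearMap.mulLeft ℝ z) (extDer f) (exteriorBaseChange w) := by
  induction w using exteriorAlgebra_left_induction with
  | algebraMap r =>
    simp [extDer_algebraMap, Algebra.TensorProduct.algebraMap_apply, extDer_one]
  | add u w hu hw => simp only [map_add, hu, hw]
  | ι_mul w v hw =>
    have hι : (ι ℝ).lTensor A (TensorProduct.map (LinearMap.mulLeft ℝ z) f v) =
        TensorProduct.map (LinearMap.mulLeft ℝ z) (extDer f) ((ι ℝ).lTensor A v) := by
      induction v with
      | zero => simp
      | tmul a x => simp [extDer_ι]
      | add v v' hv hv' => simp only [map_add, hv, hv']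
    rw [extDer_ι_mul, map_add, map_mul, map_mul, map_mul, hw, exteriorBaseChange_ι,
      exteriorBaseChange_ι, hι, map_mulLeft_extDer_mul]

end Derivation

section LieAlgebra

variable {A H : Type*} [CommRing A] [Algebra ℝ A] [LieRing H] [LieAlgebra ℝ H]

theorem exteriorBaseChange_lieDer_tmul (z : A) (x : H) (w : ExteriorAlgebra ℝ (A ⊗[ℝ] H)) :
    exteriorBaseChange (lieDer (z ⊗ₜ[ℝ] x) w) =
      TensorProduct.map (LinearMap.mulLeft ℝ z) (lieDer x) (exteriorBaseChange w) := by
  have ad_tmul : LieAlgebra.ad ℝ (A ⊗[ℝ] H) (z ⊗ₜ[ℝ] x) =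
      TensorProduct.map (LinearMap.mulLeft ℝ z) (LieAlgebra.ad ℝ H x) := by
    ext a y
    simp
  refine (congrArg (fun D => exteriorBaseChange (extDer D w)) ad_tmul).trans ?_
  exact exteriorBaseChange_extDer z _ w

theorem slice_exteriorBaseChange_mem_posInvariants (l : Module.Dual ℝ A)
    {u : ExteriorAlgebra ℝ (A ⊗[ℝ] H)} (hu : u ∈ posInvariants (A ⊗[ℝ] H)) :
    slice l (exteriorBaseChange u) ∈ posInvariants H := by
  refine ⟨?_, fun x => ?_⟩
  · have h := lTensor_algebraMapInv_exteriorBaseChange u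
    rw [hu.1, map_zero] at h
    exact (slice_map l LinearMap.id _ _).symm.trans ((congrArg _ h).trans (map_zero _))
  · have h := exteriorBaseChange_lieDer_tmul 1 x u
    rw [show lieDer (1 ⊗ₜ[ℝ] x) u = 0 from hu.2 _, map_zero, LinearMap.mulLeft_one] at h
    exact (slice_map l LinearMap.id _ _).symm.trans ((congrArg _ h.symm).trans (map_zero _))

end LieAlgebra

section ReExtension

variable {V H : Type*} [AddCommGroup V] [Module ℝ V] [LieRing H] [LieAlgebra ℝ H]

/-- The real part of the complex multilinear extension to `ℂ ⊗ V` of a form on `V`. -/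
noncomputable def reExtension (β : Module.Dual ℝ (ExteriorAlgebra ℝ V)) :
    Module.Dual ℝ (ExteriorAlgebra ℝ (ℂ ⊗[ℝ] V)) :=
  β ∘ₗ slice Complex.reLm ∘ₗ exteriorBaseChange.toLinearMap

theorem reExtension_apply (β : Module.Dual ℝ (ExteriorAlgebra ℝ V))
    (w : ExteriorAlgebra ℝ (ℂ ⊗[ℝ] V)) :
    reExtension β w = β (slice Complex.reLm (exteriorBaseChange w)) :=
  rfl

theorem reExtension_map_one_tmul (β : Module.Dual ℝ (ExteriorAlgebra ℝ V))
    (w : ExteriorAlgebra ℝ V) :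
    reExtension β (ExteriorAlgebra.map (TensorProduct.mk ℝ ℂ V 1) w) = β w := by
  rw [reExtension_apply, exteriorBaseChange_map_one_tmul, slice_tmul, Complex.reLm_coe,
    Complex.one_re, one_smul]

theorem reExtension_lieDer {β : Module.Dual ℝ (ExteriorAlgebra ℝ H)}
    (hβ : ∀ x w, β (lieDer x w) = 0) (z : ℂ ⊗[ℝ] H) (w : ExteriorAlgebra ℝ (ℂ ⊗[ℝ] H)) :
    reExtension β (lieDer z w) = 0 := by
  induction z with
  | zero => rw [map_zero, LinearMap.zero_apply, map_zero]
  | add z z' hz hz' => rw [map_add, LinearMap.add_apply, map_add, hz, hz', add_zero]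
  | tmul a x => rw [reExtension_apply, exteriorBaseChange_lieDer_tmul, slice_map, hβ]

theorem reExtension_mem_primitive {β : Module.Dual ℝ (ExteriorAlgebra ℝ H)}
    (hβ : β ∈ primitive H) : reExtension β ∈ primitive (ℂ ⊗[ℝ] H) := by
  obtain ⟨hβ_one, hβ_inv, hβ_mul⟩ := hβ
  refine ⟨?_, reExtension_lieDer hβ_inv, fun u hu w hw => ?_⟩
  · rw [← map_one (ExteriorAlgebra.map (TensorProduct.mk ℝ ℂ H 1)), reExtension_map_one_tmul,
      hβ_one]
  · have mem_posInvariants (l : Module.Dual ℝ ℂ) {v} (hv : v ∈ posInvariants (ℂ ⊗[ℝ] H)) :=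
      slice_exteriorBaseChange_mem_posInvariants l hv
    rw [reExtension_apply, map_mul, slice_reLm_mul, map_sub,
      hβ_mul _ (mem_posInvariants _ hu) _ (mem_posInvariants _ hw),
      hβ_mul _ (mem_posInvariants _ hu) _ (mem_posInvariants _ hw), sub_zero]

theorem reExtension_mem_primitiveAnti {θ : H →ₗ[ℝ] H} {β : Module.Dual ℝ (ExteriorAlgebra ℝ H)}
    (hβ : β ∈ primitiveAnti θ) :
    reExtension β ∈
      primitiveAnti (TensorProduct.map Complex.conjAe.toAlgHom.toLinearMap θ) := by
  have reLm_conj : Complex.reLm ∘ₗ Complex.conjAe.toAlgHom.toLinearMap = Complex.reLm :=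
    LinearMap.ext Complex.conj_re
  refine ⟨reExtension_mem_primitive hβ.1, fun w => ?_⟩
  rw [reExtension_apply, reExtension_apply, exteriorBaseChange_map, slice_map, reLm_conj]
  exact hβ.2 _

end ReExtension

end BaseChange

namespace ReductivePair

section RestWellDefined

variable {L : Type*} [LieRing L] [LieAlgebra ℝ L] (P : ReductivePair L)

/-- The reductive pair `(H, H)` attached to `(L, H)`. It records that `θ` restricts to a Cartan
involution of `H`. -/
noncomputable def selfPair : ReductivePair P.H where
  θ := { P.θH with map_lie' := fun {x y} => Subtype.ext (P.θ.map_lie x y) }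
  cartan := by
    obtain ⟨B, hsymm, hinv, hθ, hneg⟩ := P.cartan.exists_form
    refine ⟨fun x => Subtype.ext (P.cartan.involutive x), B.restrict P.H.toSubmodule,
      fun x y => hsymm x y, fun x y z => hinv x y z, fun x y => hθ x y, fun x hx => hneg x ?_⟩
    simpa using hx
  H := ⊤
  map_H := eq_top_iff.mpr fun x _ =>
    ⟨P.θH x, LieSubalgebra.mem_top _, Subtype.ext (P.cartan.involutive x)⟩

theorem restWellDefined [FiniteDimensional ℝ L] : P.RestWellDefined := fun _ hα =>
  pullback_mem_primitiveAnti P.selfPair.cartan P.cartan (φ := P.H.incl) (fun _ => rfl) hα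

end RestWellDefined

section Complexification

/-- The embedding of a Lie algebra into its complexification. -/
noncomputable def toComplexification (L : Type*) [LieRing L] [LieAlgebra ℝ L] :
    L →ₗ⁅ℝ⁆ ℂ ⊗[ℝ] L where
  toLinearMap := TensorProduct.mk ℝ ℂ L 1
  map_lie' {x y} := by simp

variable {L : Type*} [LieRing L] [LieAlgebra ℝ L] (P : ReductivePair L)

theorem toComplexification_θ (x : L) :
    toComplexification L (P.θ x) = P.θConj (toComplexification L x) := by
  change 1 ⊗ₜ P.θ x = P.θConj (1 ⊗ₜ x)
  simp [θConj]

/-- The isomorphism of `ℂ ⊗ H` with its image in `ℂ ⊗ L`. -/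
noncomputable def equivHC : ℂ ⊗[ℝ] P.H ≃ₗ⁅ℝ⁆ P.complexify.H :=
  LieEquiv.ofInjective (LieAlgebra.ExtendScalars.map (AlgHom.id ℝ ℂ) P.H.incl)
    (Module.Flat.lTensor_preserves_injective_linearMap (M := ℂ) P.H.toSubmodule.subtype
      P.H.toSubmodule.injective_subtype)

theorem equivHC_symm_θ (x : P.complexify.H) :
    P.equivHC.symm (P.complexify.selfPair.θ x) = P.selfPair.θConj (P.equivHC.symm x) := by
  have equivHC_θ (w : ℂ ⊗[ℝ] P.H) :
      P.equivHC (P.selfPair.θConj w) = P.complexify.selfPair.θ (P.equivHC w) := by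
    induction w with
    | zero => simp only [map_zero]
    | add a b ha hb => simp only [map_add, ha, hb]
    | tmul z x => rfl
  obtain ⟨w, rfl⟩ : ∃ w, P.equivHC w = x := P.equivHC.surjective x
  rw [← equivHC_θ, LieEquiv.symm_apply_apply, LieEquiv.symm_apply_apply]

theorem rest_pullback_toComplexification (α : Module.Dual ℝ (ExteriorAlgebra ℝ (ℂ ⊗[ℝ] L))) :
    rest P.H (pullback (toComplexification L) α) =
      pullback ((P.equivHC : ℂ ⊗[ℝ] P.H →ₗ⁅ℝ⁆ P.complexify.H).comp (toComplexification P.H))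
        (rest P.complexify.H α) := by
  rw [rest_eq_pullback, rest_eq_pullback, pullback_pullback, pullback_pullback]
  rfl

theorem pullback_equivHC_symm (γ : Module.Dual ℝ (ExteriorAlgebra ℝ (ℂ ⊗[ℝ] P.H))) :
    pullback ((P.equivHC : ℂ ⊗[ℝ] P.H →ₗ⁅ℝ⁆ P.complexify.H).comp (toComplexification P.H))
        (pullback (P.equivHC.symm : P.complexify.H →ₗ⁅ℝ⁆ ℂ ⊗[ℝ] P.H) γ) =
      pullback (toComplexification P.H) γ := by
  rw [pullback_pullback]
  exact congrArg (pullback · γ) (LieHom.ext fun x => P.equivHC.symm_apply_apply _)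

theorem rest_pullback_eq_of_rest_eq_reExtension {α : Module.Dual ℝ (ExteriorAlgebra ℝ (ℂ ⊗[ℝ] L))}
    {β : Module.Dual ℝ (ExteriorAlgebra ℝ P.H)}
    (h : rest P.complexify.H α =
      pullback (P.equivHC.symm : P.complexify.H →ₗ⁅ℝ⁆ ℂ ⊗[ℝ] P.H) (reExtension β)) :
    rest P.H (pullback (toComplexification L) α) = β := by
  rw [rest_pullback_toComplexification, h, pullback_equivHC_symm]
  exact LinearMap.ext (reExtension_map_one_tmul β)

end Complexification

end ReductivePair

end RedPair

theorem mainTheorem8 {L₀ : Type*} [LieRing L₀] [LieAlgebra ℝ L₀] [FiniteDimensional ℝ L₀]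
    (P₀ : RedPair.ReductivePair L₀) :
    ∃ (hC : P₀.complexify.RestWellDefined) (h₀ : P₀.RestWellDefined),
      Function.Surjective (P₀.complexify.restAnti hC) →
        Function.Surjective (P₀.restAnti h₀) := by
  refine ⟨P₀.complexify.restWellDefined, P₀.restWellDefined, ?_⟩
  rintro surjective ⟨β, hβ⟩
  have extension_mem := RedPair.pullback_mem_primitiveAnti P₀.complexify.selfPair.cartan
    P₀.selfPair.θConj_isCartanInvolution P₀.equivHC_symm_θ
    (RedPair.reExtension_mem_primitiveAnti hβ)
  obtain ⟨⟨α, hα⟩, hrest⟩ := surjective ⟨_, extension_mem⟩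
  refine ⟨⟨RedPair.pullback (RedPair.ReductivePair.toComplexification L₀) α,
    RedPair.pullback_mem_primitiveAnti P₀.cartan P₀.complexify.cartan P₀.toComplexification_θ hα⟩,
    Subtype.ext ?_⟩
  exact P₀.rest_pullback_eq_of_rest_eq_reExtension (congrArg Subtype.val hrest)
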